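/- All graphs are finite and simple. Let $G$ be a graph and $S\subseteq V(G)$ with $|S|\ge 2$. A \emph{pendant $S$-Steiner tree} of $G$ is a subgraph $T$ of $G$ that is a tree, satisfies $S\subseteq V(T)$, and in which every vertex of $S$ has degree $1$. Two such trees $T,T'$ are \emph{internally disjoint} if $E(T)\cap E(T')=\varnothing$ and $V(T)\cap V(T')=S$. Let $\tau_G(S)$ be the maximum number of pairwise internally disjoint pendant $S$-Steiner trees in $G$, and for $|V(G)|\ge 3$ let $$\tau_3(G)=\min\{\tau_G(S) : S\subseteq V(G),\ |S|=3\}.$$ Let $L(G)$ denote the line graph of $G$, $K_{a,b}$ the complete bipartite graph with parts of sizes $a$ and $b$, $K_n$ the complete graph of order $n$, and $\Box$ the Cartesian product of graphs. **Theorem.** For any two integers $p\ge 0$ and $q$ with $q\ge 2p$, there exists a graph $G$ such that $\tau_3(G)=p$ and $\tau_3(L(G))=q$. More precisely, $G=K_{p+2,\,q-p+2}$ has these properties, and its line graph $L(G)$ is isomorphic to $K_{p+2}\,\Box\, K_{q-p+2}$. -/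

import Mathlib

namespace PendantTree

variable {V : Type*}

/-- `T` is a pendant `S`-Steiner tree of `G`: a subgraph of `G` that is a tree, contains all
vertices of `S`, and in which every vertex of `S` has degree one. -/
structure IsPendantSteinerTree (G : SimpleGraph V) (S : Set V) (T : G.Subgraph) : Prop where
  isTree : T.coe.IsTree
  subset_verts : S ⊆ T.verts
  degree_eq_one : ∀ v ∈ S, (T.neighborSet v).encard = 1

/-- Internal disjointness of two `S`-Steiner trees: no common edge, and exactly the vertices of
`S` in common. -/
def InternallyDisjoint (G : SimpleGraph V) (S : Set V) (T T' : G.Subgraph) : Prop :=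
  T.edgeSet ∩ T'.edgeSet = ∅ ∧ T.verts ∩ T'.verts = S

/-- The pendant-tree local connectivity `τ_G(S)`: the maximum number of pairwise internally
disjoint pendant `S`-Steiner trees in `G`. -/
noncomputable def localConnectivity (G : SimpleGraph V) (S : Set V) : ℕ∞ :=
  sSup {m : ℕ∞ | ∃ F : Set G.Subgraph, (∀ T ∈ F, IsPendantSteinerTree G S T) ∧
    F.Pairwise (InternallyDisjoint G S) ∧ F.encard = m}

/-- The pendant-tree `k`-connectivity `τ_k(G)`: the minimum of `τ_G(S)` over all sets `S` of
exactly `k` vertices. It is `⊤` (so no natural number) if `G` has fewer than `k` vertices. -/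
noncomputable def connectivity (k : ℕ) (G : SimpleGraph V) : ℕ∞ :=
  sInf {m : ℕ∞ | ∃ S : Set V, S.encard = k ∧ localConnectivity G S = m}

end PendantTree

/-!
The trees through a fixed terminal `x` use distinct edges at `x`, and with more than two terminals
these edges lead to non-terminals, so `τ(S)` is at most the number of non-terminal neighbours of
`x`. Conversely, disjoint connected sets of non-terminals, each with a neighbour of every terminal,
extend to internally disjoint pendant trees. In a complete bipartite graph such sets are single
vertices or edges. In the rook's graph they lie on lines, being the projections to a row or column
of the terminals outside it; at most four lines have to be given up before these sets avoid the
terminals and become disjoint.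
-/

namespace PendantTree

open SimpleGraph

section Leaves

variable {V : Type*} {G : SimpleGraph V} {U : Set V}

theorem isAcyclic_of_isAcyclic_induce (hU : (G.induce U).IsAcyclic)
    (hleaf : ∀ v ∉ U, (G.neighborSet v).Subsingleton) : G.IsAcyclic := by
  intro v c hc
  have hsupp : ∀ w ∈ c.support, w ∈ U := fun w hw => by
    by_contra hwU
    have hsub := (hleaf w hwU).anti (c.toSubgraph.neighborSet_subset w)
    obtain ⟨a, b, hab, hc⟩ := Set.ncard_eq_two.1 (hc.ncard_neighborSet_toSubgraph_eq_two hw)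
    rw [hc] at hsub
    exact hab (hsub (by simp) (by simp))
  refine hU (c.induce U hsupp) ?_
  rwa [← Walk.isCycle_map_iff_of_injective (f := (Embedding.induce U).toHom)
    (Embedding.induce (G := G) U).injective,
    Walk.map_induce]

theorem isTree_of_isTree_induce (hU : (G.induce U).IsTree)
    (hleaf : ∀ v ∉ U, ∃ u ∈ U, G.neighborSet v = {u}) : G.IsTree := by
  obtain ⟨root⟩ := hU.connected.nonempty
  have reachable_of_mem : ∀ w ∈ U, G.Reachable root w := fun w hw =>
    (hU.connected.preconnected root ⟨w, hw⟩).map (Embedding.induce U).toHom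
  refine ⟨connected_iff_exists_forall_reachable _ |>.2 ⟨root, fun w => ?_⟩,
    isAcyclic_of_isAcyclic_induce hU.isAcyclic fun v hv => ?_⟩
  · by_cases hw : w ∈ U
    · exact reachable_of_mem w hw
    · obtain ⟨u, hu, hwu⟩ := hleaf w hw
      have hadj : G.Adj w u := (G.mem_neighborSet w u).1 (hwu ▸ Set.mem_singleton u)
      exact (reachable_of_mem u hu).trans hadj.symm.reachable
  · obtain ⟨u, -, hvu⟩ := hleaf v hv
    exact hvu ▸ Set.subsingleton_singleton

theorem eq_or_eq_of_adj_of_subsingleton_neighborSet (hG : G.Preconnected) {u v : V}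
    (huv : G.Adj u v) (hu : (G.neighborSet u).Subsingleton)
    (hv : (G.neighborSet v).Subsingleton) (w : V) : w = u ∨ w = v := by
  by_contra! hw
  obtain ⟨p, hp⟩ := hG.exists_isPath u w
  have hsnd : p.snd = v := hu (p.adj_snd (Walk.not_nil_of_ne hw.1.symm)) huv
  exact hp.not_mem_support_of_subsingleton_neighborSet huv.ne' hw.2.symm hv
    (hsnd ▸ p.getVert_mem_support 1)

end Leaves

section LocalConnectivity

variable {V : Type*} {G : SimpleGraph V} {S U : Set V} {k : ℕ}

theorem encard_pair_le (u v : V) : ({u, v} : Set V).encard ≤ 2 := by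
  grw [Set.encard_insert_le, Set.encard_singleton]
  norm_num

theorem connectivity_le_localConnectivity (hS : S.encard = k) :
    connectivity k G ≤ localConnectivity G S :=
  sInf_le ⟨S, hS, rfl⟩

theorem le_connectivity {n : ℕ∞} (h : ∀ S : Set V, S.encard = k → n ≤ localConnectivity G S) :
    n ≤ connectivity k G :=
  le_sInf fun _ ⟨S, hS, hm⟩ => hm ▸ h S hS

theorem IsPendantSteinerTree.notMem_of_adj {T : G.Subgraph} (hT : IsPendantSteinerTree G S T)
    (hS : 2 < S.encard) {u v : V} (hu : u ∈ S) (huv : T.Adj u v) : v ∉ S := by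
  intro hv
  have subsingleton_neighborSet : ∀ w (hw : w ∈ S),
      (T.coe.neighborSet ⟨w, hT.subset_verts hw⟩).Subsingleton := fun w hw a ha b hb =>
    Subtype.ext (Set.encard_le_one_iff.1 (hT.degree_eq_one w hw).le a b ha hb)
  have hsub : S ⊆ {u, v} := fun w hw =>
    (eq_or_eq_of_adj_of_subsingleton_neighborSet hT.isTree.connected.preconnected huv.coe
      (subsingleton_neighborSet u hu) (subsingleton_neighborSet v hv)
      ⟨w, hT.subset_verts hw⟩).imp (congrArg Subtype.val) (congrArg Subtype.val)
  exact hS.not_ge ((Set.encard_le_encard hsub).trans (encard_pair_le u v))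

theorem localConnectivity_le_encard_neighborSet_diff (hS : 2 < S.encard) {x : V} (hx : x ∈ S) :
    localConnectivity G S ≤ (G.neighborSet x \ S).encard := by
  refine sSup_le ?_
  rintro _ ⟨F, hF, hdisj, rfl⟩
  have : Nonempty V := ⟨x⟩
  have exists_adj : ∀ T ∈ F, ∃ v, T.Adj x v := fun T hT =>
    Set.encard_ne_zero (s := T.neighborSet x).1 <| by
      rw [(hF T hT).degree_eq_one x hx]
      exact one_ne_zero
  choose! f hf using exists_adj
  refine Set.encard_le_encard_of_injOn (f := f)
    (fun T hT => ⟨(hf T hT).adj_sub, (hF T hT).notMem_of_adj hS hx (hf T hT)⟩) ?_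
  intro T hT T' hT' heq
  by_contra hne
  exact Set.eq_empty_iff_forall_notMem.1 (hdisj hT hT' hne).1 s(x, f T)
    ⟨hf T hT, heq ▸ hf T' hT'⟩

theorem internallyDisjoint_of_verts_inter {T T' : G.Subgraph} (hT : ∀ u ∈ S, ∀ v ∈ S, ¬T.Adj u v)
    (hverts : T.verts ∩ T'.verts = S) : InternallyDisjoint G S T T' := by
  refine ⟨Set.eq_empty_iff_forall_notMem.2 (Sym2.ind fun u v => ?_), hverts⟩
  rintro ⟨huv : T.Adj u v, huv' : T'.Adj u v⟩
  exact hT u (hverts ▸ ⟨huv.fst_mem, huv'.fst_mem⟩) v (hverts ▸ ⟨huv.snd_mem, huv'.snd_mem⟩) huv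

/-- `U` is an `S`-connector of `G`: a connected set of non-terminals with a neighbour of every
terminal in `S`. These are the sets from which a pendant `S`-Steiner tree arises by attaching the
terminals as leaves to a spanning tree. -/
structure IsConnector (G : SimpleGraph V) (S U : Set V) : Prop where
  connected : (G.induce U).Connected
  disjoint : Disjoint U S
  exists_adj : ∀ s ∈ S, ∃ u ∈ U, G.Adj s u

theorem isConnector_of_isClique (hU : G.IsClique U) (hne : U.Nonempty) (hdisj : Disjoint U S)
    (hadj : ∀ s ∈ S, ∃ u ∈ U, G.Adj s u) : IsConnector G S U where
  connected := by
    have := hne.to_subtype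
    rw [induce_eq_top.2 hU]
    exact connected_top
  disjoint := hdisj
  exists_adj := hadj

theorem isConnector_image_of_isClique {L : Set V} (hL : G.IsClique L) {π : V → V}
    (hne : (S \ L).Nonempty) (hπ : ∀ s ∈ S \ L, π s ∈ L \ S)
    (hadj : ∀ s ∈ S \ L, G.Adj s (π s)) : IsConnector G S (π '' (S \ L)) := by
  obtain ⟨t, ht⟩ := hne
  refine isConnector_of_isClique (hL.subset ?_) ⟨_, t, ht, rfl⟩ ?_ fun s hs => ?_
  · exact Set.image_subset_iff.2 fun s hs => (hπ s hs).1
  · exact Set.disjoint_left.2 (Set.forall_mem_image.2 fun s hs => (hπ s hs).2)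
  · by_cases hsL : s ∈ L
    · have hst : s ≠ π t := fun h => (hπ t ht).2 (h ▸ hs)
      exact ⟨π t, ⟨t, ht, rfl⟩, hL hsL (hπ t ht).1 hst⟩
    · exact ⟨π s, ⟨s, ⟨hs, hsL⟩, rfl⟩, hadj s ⟨hs, hsL⟩⟩

theorem isConnector_singleton {u : V} (hu : ∀ s ∈ S, G.Adj s u) : IsConnector G S {u} :=
  isConnector_of_isClique (isClique_singleton u) (Set.singleton_nonempty u)
    (Set.disjoint_singleton_left.2 fun hmem => (hu u hmem).ne rfl)
    fun s hs => ⟨u, rfl, hu s hs⟩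

theorem IsConnector.exists_isPendantSteinerTree (hU : IsConnector G S U) :
    ∃ T : G.Subgraph, IsPendantSteinerTree G S T ∧ T.verts = U ∪ S ∧
      ∀ u ∈ S, ∀ v ∈ S, ¬T.Adj u v := by
  obtain ⟨t, htG, ht⟩ := hU.connected.exists_isTree_le
  choose! f hfU hfadj using hU.exists_adj
  have notMem_U : ∀ s ∈ S, s ∉ U := fun s hs hsU => hU.disjoint.notMem_of_mem_left hsU hs
  let T : G.Subgraph :=
    { verts := U ∪ S
      Adj v w := (∃ (hv : v ∈ U) (hw : w ∈ U), t.Adj ⟨v, hv⟩ ⟨w, hw⟩) ∨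
        (v ∈ S ∧ w = f v) ∨ (w ∈ S ∧ v = f w)
      adj_sub := by
        rintro v w (⟨hv, hw, h⟩ | ⟨hv, rfl⟩ | ⟨hw, rfl⟩)
        exacts [htG h, hfadj v hv, (hfadj w hw).symm]
      edge_vert := by
        rintro v w (⟨hv, -, -⟩ | ⟨hv, -⟩ | ⟨hw, rfl⟩)
        exacts [.inl hv, .inr hv, .inl (hfU w hw)]
      symm.symm := by
        rintro v w (⟨hv, hw, h⟩ | h | h)
        exacts [.inl ⟨hw, hv, h.symm⟩, .inr (.inr h), .inr (.inl h)] }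
  have adj_iff : ∀ s ∈ S, ∀ w, T.Adj s w ↔ w = f s := fun s hs w => by
    grind
  have adj_coe_iff : ∀ v w : U, T.Adj v w ↔ t.Adj v w := fun v w => by
    grind
  have induceIso : t ≃g T.coe.induce {v : T.verts | (v : V) ∈ U} :=
    { toFun u := ⟨⟨u, .inl u.2⟩, u.2⟩
      invFun v := ⟨v.1, v.2⟩
      map_rel_iff' := adj_coe_iff _ _ }
  refine ⟨T, ⟨?_, Set.subset_union_right, fun s hs => ?_⟩, rfl, fun u hu v hv huv => ?_⟩
  · refine isTree_of_isTree_induce (induceIso.isTree_iff.1 ht) fun v hv => ?_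
    have hvS : (v : V) ∈ S := v.2.resolve_left hv
    refine ⟨⟨f v, .inl (hfU v hvS)⟩, hfU v hvS, Set.ext fun w => ?_⟩
    simpa [Subtype.ext_iff] using adj_iff v hvS w
  · exact Set.encard_eq_one.2 ⟨f s, Set.ext (adj_iff s hs)⟩
  · exact notMem_U v hv ((adj_iff u hu v).1 huv ▸ hfU u hu)

theorem card_le_localConnectivity {ι : Type*} {U : ι → Set V}
    (hU : ∀ i, IsConnector G S (U i)) (hdisj : Pairwise (Function.onFun Disjoint U)) :
    ENat.card ι ≤ localConnectivity G S := by
  choose T hT hverts hindep using fun i => (hU i).exists_isPendantSteinerTree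
  have inter_verts : ∀ i j, i ≠ j → (T i).verts ∩ (T j).verts = S := fun i j hij => by
    rw [hverts, hverts, ← Set.inter_union_distrib_right, (hdisj hij).inter_eq, Set.empty_union]
  have injective_T : Function.Injective T := fun i j hij => by
    by_contra hne
    obtain ⟨u, hu⟩ := Set.nonempty_coe_sort.1 (hU i).connected.nonempty
    have huS : u ∈ S := by
      rw [← inter_verts i j hne, ← hij, Set.inter_self, hverts]
      exact .inl hu
    exact (hU i).disjoint.notMem_of_mem_left hu huS
  refine injective_T.encard_range.trans (le_sSup ⟨Set.range T, ?_, ?_, rfl⟩)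
  · exact Set.forall_mem_range.2 hT
  · rintro _ ⟨i, rfl⟩ _ ⟨j, rfl⟩ hne
    exact internallyDisjoint_of_verts_inter (hindep i)
      (inter_verts i j fun hij => hne (congrArg T hij))

theorem card_le_localConnectivity_of_forall_adj {ι : Type*} {f : ι → V} (hf : f.Injective)
    (hadj : ∀ i, ∀ s ∈ S, G.Adj s (f i)) : ENat.card ι ≤ localConnectivity G S :=
  card_le_localConnectivity (fun i => isConnector_singleton (hadj i))
    fun _ _ hij => Set.disjoint_singleton.2 (hf.ne hij)

end LocalConnectivity

section Iso

variable {V V' : Type*} {G : SimpleGraph V} {G' : SimpleGraph V'} {S : Set V}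

theorem IsPendantSteinerTree.map (e : G ≃g G') {T : G.Subgraph}
    (hT : IsPendantSteinerTree G S T) :
    IsPendantSteinerTree G' (e '' S) (T.map e.toHom) where
  isTree := by
    let coeIso : T.coe ≃g (T.map e.toHom).coe :=
      { e.toEquiv.image T.verts with
        map_rel_iff' := Relation.map_apply_apply e.injective e.injective _ _ _ }
    exact coeIso.isTree_iff.1 hT.isTree
  subset_verts := Set.image_mono hT.subset_verts
  degree_eq_one := by
    rintro _ ⟨v, hv, rfl⟩
    have neighborSet_map : (T.map e.toHom).neighborSet (e v) = e '' T.neighborSet v := by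
      ext w
      simp [Relation.Map]
    rw [neighborSet_map, e.injective.encard_image, hT.degree_eq_one v hv]

theorem InternallyDisjoint.map (e : G ≃g G') {T T' : G.Subgraph}
    (h : InternallyDisjoint G S T T') :
    InternallyDisjoint G' (e '' S) (T.map e.toHom) (T'.map e.toHom) := by
  constructor
  · rw [Subgraph.edgeSet_map, Subgraph.edgeSet_map,
      ← Set.image_inter (Sym2.map.injective (f := e.toHom) e.injective), h.1, Set.image_empty]
  · rw [Subgraph.map_verts, Subgraph.map_verts]
    exact (Set.image_inter e.injective).symm.trans (congrArg _ h.2)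

theorem localConnectivity_le_localConnectivity_image (e : G ≃g G') (S : Set V) :
    localConnectivity G S ≤ localConnectivity G' (e '' S) := by
  refine sSup_le ?_
  rintro _ ⟨F, hF, hdisj, rfl⟩
  have injective_map : Function.Injective (Subgraph.map e.toHom) := fun T T' h => by
    have map_symm_map : ∀ T : G.Subgraph, (T.map e.toHom).map e.symm.toHom = T := fun T => by
      have symm_comp : e.symm.toHom.comp e.toHom = Hom.id := RelHom.ext e.symm_apply_apply
      rw [← Subgraph.map_comp, symm_comp, Subgraph.map_id]
    rw [← map_symm_map T, h, map_symm_map]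
  refine le_sSup ⟨Subgraph.map e.toHom '' F, ?_, ?_, injective_map.encard_image F⟩
  · exact Set.forall_mem_image.2 fun T hT => (hF T hT).map e
  · exact Set.Pairwise.image (hdisj.mono' fun T T' h => h.map e)

theorem connectivity_le_of_iso (e : G ≃g G') (k : ℕ) : connectivity k G ≤ connectivity k G' :=
  le_connectivity fun S hS => by
    calc connectivity k G
        ≤ localConnectivity G (e.symm '' S) := connectivity_le_localConnectivity <| by
          rw [e.symm.injective.encard_image, hS]
      _ ≤ localConnectivity G' (e '' (e.symm '' S)) :=
          localConnectivity_le_localConnectivity_image e _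
      _ = localConnectivity G' S := by
          simp [← Set.image_comp]

theorem connectivity_congr (e : G ≃g G') (k : ℕ) : connectivity k G = connectivity k G' :=
  (connectivity_le_of_iso e k).antisymm (connectivity_le_of_iso e.symm k)

end Iso

section CompleteBipartite

variable {α β : Type*} {k : ℕ}

theorem isConnector_pair_completeBipartiteGraph {S : Set (α ⊕ β)} {a : α} {b : β}
    (ha : .inl a ∉ S) (hb : .inr b ∉ S) :
    IsConnector (completeBipartiteGraph α β) S {.inl a, .inr b} := by
  refine isConnector_of_isClique ?_ (Set.insert_nonempty _ _) ?_ ?_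
  · exact isClique_pair.2 fun _ => by simp
  · simp [Set.disjoint_insert_left, ha, hb]
  · rintro (s | s) - <;> simp

theorem connectivity_completeBipartiteGraph_comm (α β : Type*) (k : ℕ) :
    connectivity k (completeBipartiteGraph α β) = connectivity k (completeBipartiteGraph β α) :=
  connectivity_congr ⟨Equiv.sumComm α β, by simp [and_comm, or_comm]⟩ k

theorem connectivity_completeBipartiteGraph_le [Nonempty β] (hk : 2 ≤ k) (hα : k ≤ ENat.card α) :
    connectivity (k + 1) (completeBipartiteGraph α β) ≤ ENat.card α - k := by
  obtain ⟨A, -, hA⟩ := Set.exists_subset_encard_eq (Set.encard_univ α ▸ hα)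
  obtain ⟨b⟩ := ‹Nonempty β›
  set S : Set (α ⊕ β) := insert (.inr b) (.inl '' A) with hS
  have encard_S : S.encard = (k + 1 : ℕ) := by
    rw [Set.encard_insert_of_notMem (by simp), Sum.inl_injective.encard_image, hA, Nat.cast_succ]
  have neighborSet_diff : (completeBipartiteGraph α β).neighborSet (.inr b) \ S ⊆ .inl '' Aᶜ := by
    rintro (a | b') <;> simp [hS]
  calc connectivity (k + 1) (completeBipartiteGraph α β)
      ≤ localConnectivity _ S := connectivity_le_localConnectivity encard_S
    _ ≤ ((completeBipartiteGraph α β).neighborSet (.inr b) \ S).encard :=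
        localConnectivity_le_encard_neighborSet_diff
          (encard_S ▸ Nat.cast_lt.2 (Nat.lt_succ_of_le hk)) (Set.mem_insert _ _)
    _ ≤ Aᶜ.encard := (Set.encard_le_encard neighborSet_diff).trans
        (Sum.inl_injective.encard_image _).le
    _ ≤ ENat.card α - k := by
        refine ENat.le_sub_of_add_le_right (ENat.natCast_ne_top k) ?_
        rw [add_comm, ← hA, Set.encard_add_encard_compl, Set.encard_univ]

theorem encard_preimage_le_of_notMem_range {V : Type*} {S : Set V} {f : α → V}
    (hf : f.Injective) (hS : S.encard = (k + 1 : ℕ)) {v : V} (hv : v ∈ S)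
    (hvf : v ∉ Set.range f) : (f ⁻¹' S).encard ≤ k := by
  have insert_subset : insert v (f '' (f ⁻¹' S)) ⊆ S :=
    Set.insert_subset hv (Set.image_preimage_subset f S)
  have hcard := Set.encard_le_encard insert_subset
  rwa [Set.encard_insert_of_notMem fun h => hvf (Set.image_subset_range _ _ h),
    hf.encard_image, hS, Nat.cast_succ, ENat.add_le_add_iff_right ENat.one_ne_top] at hcard

theorem exists_embedding_forall_notMem {A : Set α} (hA : A.encard ≤ k) {n : ℕ}
    (hn : (n : ℕ∞) + k ≤ ENat.card α) : ∃ f : Fin n ↪ α, ∀ i, f i ∉ A := by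
  have : Finite A := Set.finite_of_encard_le_coe hA
  have hAn : (A.ncard : ℕ∞) + n ≤ ENat.card α := by
    rw [A.toFinite.cast_ncard_eq, add_comm]
    exact (add_le_add_right hA _).trans hn
  obtain ⟨f, hf⟩ := Fin.Embedding.exists_embedding_disjoint_range_of_add_le_ENat_card hAn
  exact ⟨f, fun i hi => hf.notMem_of_mem_left hi ⟨i, rfl⟩⟩

theorem le_localConnectivity_completeBipartiteGraph {S : Set (α ⊕ β)}
    (hS : S.encard = (k + 1 : ℕ)) {a : α} (ha : .inl a ∈ S) {b : β} (hb : .inr b ∈ S) {n : ℕ}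
    (hα : (n : ℕ∞) + k ≤ ENat.card α) (hβ : (n : ℕ∞) + k ≤ ENat.card β) :
    n ≤ localConnectivity (completeBipartiteGraph α β) S := by
  obtain ⟨f, hf⟩ := exists_embedding_forall_notMem
    (encard_preimage_le_of_notMem_range Sum.inl_injective hS hb (by simp)) hα
  obtain ⟨g, hg⟩ := exists_embedding_forall_notMem
    (encard_preimage_le_of_notMem_range Sum.inr_injective hS ha (by simp)) hβ
  have hU := card_le_localConnectivity (S := S)
    (fun i => isConnector_pair_completeBipartiteGraph (hf i) (hg i))
    fun i j hij => by simpa [Function.onFun] using hij.symm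
  simpa using hU

theorem connectivity_completeBipartiteGraph (hk : 2 ≤ k) (hα : k ≤ ENat.card α)
    (hβ : k ≤ ENat.card β) :
    connectivity (k + 1) (completeBipartiteGraph α β) = min (ENat.card α) (ENat.card β) - k := by
  have : Nonempty α := (ENat.one_le_card_iff_nonempty α).1 <|
    (Nat.one_le_cast.2 (by omega)).trans hα
  have : Nonempty β := (ENat.one_le_card_iff_nonempty β).1 <|
    (Nat.one_le_cast.2 (by omega)).trans hβ
  refine le_antisymm ?_ (le_connectivity fun S hS => ENat.forall_natCast_le_iff_le.1 fun n hn => ?_)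
  · rcases min_choice (ENat.card α) (ENat.card β) with h | h <;> rw [h]
    · exact connectivity_completeBipartiteGraph_le hk hα
    · exact connectivity_completeBipartiteGraph_comm α β _ ▸
        connectivity_completeBipartiteGraph_le hk hβ
  obtain ⟨hnα, hnβ⟩ : (n : ℕ∞) + k ≤ ENat.card α ∧ (n : ℕ∞) + k ≤ ENat.card β := by
    rw [← le_min_iff]
    exact (add_le_add_left hn _).trans (tsub_add_cancel_of_le (le_min hα hβ)).le
  by_cases hA : ∃ a, .inl a ∈ S
  · by_cases hB : ∃ b, .inr b ∈ S
    · obtain ⟨⟨a, ha⟩, b, hb⟩ := And.intro hA hB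
      exact le_localConnectivity_completeBipartiteGraph hS ha hb hnα hnβ
    · exact (le_self_add.trans hnβ).trans <| card_le_localConnectivity_of_forall_adj
        Sum.inr_injective fun b => by simpa using fun b hb => (hB ⟨b, hb⟩).elim
  · exact (le_self_add.trans hnα).trans <| card_le_localConnectivity_of_forall_adj
      Sum.inl_injective fun a => by simpa using fun a ha => (hA ⟨a, ha⟩).elim

end CompleteBipartite

section Rook

/-- The rook's graph `K_α □ K_β` on the board with rows `α` and columns `β`: distinct cells are
adjacent when they lie in a common row or column. -/
abbrev rookGraph (α β : Type*) : SimpleGraph (α × β) := (⊤ : SimpleGraph α) □ (⊤ : SimpleGraph β)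

variable {α β : Type*} {S : Set (α × β)} {a : α} {b : β}

/-- The candidate for a connector on row `a`: the projections to it of the terminals
outside it. -/
def rowConnector (S : Set (α × β)) (a : α) : Set (α × β) :=
  (fun s => (a, s.2)) '' {s ∈ S | s.1 ≠ a}

/-- The candidate for a connector on column `b`: the projections to it of the
terminals outside it. -/
def columnConnector (S : Set (α × β)) (b : β) : Set (α × β) :=
  (fun s => (s.1, b)) '' {s ∈ S | s.2 ≠ b}

theorem isConnector_rowConnector (hne : ∃ s ∈ S, s.1 ≠ a)
    (hS : ∀ s ∈ S, s.1 ≠ a → (a, s.2) ∉ S) : IsConnector (rookGraph α β) S (rowConnector S a) := by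
  have isClique_row : (rookGraph α β).IsClique {s | s.1 = a} := fun s hs t ht hst =>
    boxProd_adj.2 (.inr ⟨fun h => hst (Prod.ext (hs.trans ht.symm) h), hs.trans ht.symm⟩)
  exact isConnector_image_of_isClique isClique_row hne (fun s hs => ⟨rfl, hS s hs.1 hs.2⟩)
    fun s hs => boxProd_adj.2 (.inl ⟨hs.2, rfl⟩)

theorem isConnector_columnConnector (hne : ∃ s ∈ S, s.2 ≠ b)
    (hS : ∀ s ∈ S, s.2 ≠ b → (s.1, b) ∉ S) :
    IsConnector (rookGraph α β) S (columnConnector S b) := by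
  have isClique_column : (rookGraph α β).IsClique {s | s.2 = b} := fun s hs t ht hst =>
    boxProd_adj.2 (.inl ⟨fun h => hst (Prod.ext h (hs.trans ht.symm)), hs.trans ht.symm⟩)
  exact isConnector_image_of_isClique isClique_column hne (fun s hs => ⟨rfl, hS s hs.1 hs.2⟩)
    fun s hs => boxProd_adj.2 (.inr ⟨hs.2, rfl⟩)

/-- The rows `D` and columns `E` are exceptional for the terminals `S` of the rook's graph: the
connectors along all other rows and columns exist, and they are pairwise disjoint because no two of
them cross. -/
structure IsExceptional (S : Set (α × β)) (D : Set α) (E : Set β) : Prop where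
  exists_fst_ne : ∀ a ∉ D, ∃ s ∈ S, s.1 ≠ a
  row_notMem : ∀ a ∉ D, ∀ s ∈ S, s.1 ≠ a → (a, s.2) ∉ S
  exists_snd_ne : ∀ b ∉ E, ∃ s ∈ S, s.2 ≠ b
  column_notMem : ∀ b ∉ E, ∀ s ∈ S, s.2 ≠ b → (s.1, b) ∉ S
  collinear : ∀ s ∈ S, ∀ t ∈ S, s.1 ∉ D → t.2 ∉ E → s.1 = t.1 ∨ s.2 = t.2

theorem IsExceptional.swap {D : Set α} {E : Set β} (h : IsExceptional S D E) :
    IsExceptional (Prod.swap '' S) E D where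
  exists_fst_ne b hb := Set.exists_mem_image.2 (h.exists_snd_ne b hb)
  row_notMem b hb := Set.forall_mem_image.2 fun s hs hsb => by
    simpa using h.column_notMem b hb s hs hsb
  exists_snd_ne a ha := Set.exists_mem_image.2 (h.exists_fst_ne a ha)
  column_notMem a ha := Set.forall_mem_image.2 fun s hs hsa => by
    simpa using h.row_notMem a ha s hs hsa
  collinear := by
    rintro _ ⟨s, hs, rfl⟩ _ ⟨t, ht, rfl⟩ hsE htD
    exact (h.collinear t ht s hs htD hsE).symm.imp Eq.symm Eq.symm

theorem IsExceptional.encard_compl_add_encard_compl_le {D : Set α} {E : Set β}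
    (h : IsExceptional S D E) :
    Dᶜ.encard + Eᶜ.encard ≤ localConnectivity (rookGraph α β) S := by
  have disjoint_row_row : ∀ a a' : α, a ≠ a' → Disjoint (rowConnector S a) (rowConnector S a') := by
    rintro a a' hne
    rw [Set.disjoint_left]
    rintro _ ⟨s, -, rfl⟩ ⟨t, -, hst⟩
    exact hne (congrArg Prod.fst hst).symm
  have disjoint_column_column : ∀ b b' : β, b ≠ b' →
      Disjoint (columnConnector S b) (columnConnector S b') := by
    rintro b b' hne
    rw [Set.disjoint_left]
    rintro _ ⟨s, -, rfl⟩ ⟨t, -, hst⟩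
    exact hne (congrArg Prod.snd hst).symm
  have disjoint_row_column : ∀ a ∉ D, ∀ b ∉ E,
      Disjoint (rowConnector S a) (columnConnector S b) := by
    rintro a ha b hb
    rw [Set.disjoint_left]
    rintro _ ⟨t, ⟨ht, hta⟩, rfl⟩ ⟨s, ⟨hs, hsb⟩, hst⟩
    obtain ⟨rfl, rfl⟩ := Prod.mk.inj hst
    exact (h.collinear s hs t ht ha hb).elim hta.symm hsb
  rw [Set.encard, Set.encard, ← ENat.card_sum]
  refine card_le_localConnectivity
    (U := Sum.elim (fun a : ↥Dᶜ => rowConnector S a) (fun b : ↥Eᶜ => columnConnector S b)) ?_ ?_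
  · rintro (a | b)
    · exact isConnector_rowConnector (h.exists_fst_ne a a.2) (h.row_notMem a a.2)
    · exact isConnector_columnConnector (h.exists_snd_ne b b.2) (h.column_notMem b b.2)
  · rintro (a | b) (a' | b') hne
    · exact disjoint_row_row a a' fun haa' => hne (congrArg _ (Subtype.ext haa'))
    · exact disjoint_row_column a a.2 b' b'.2
    · exact (disjoint_row_column a' a'.2 b b.2).symm
    · exact disjoint_column_column b b' fun hbb' => hne (congrArg _ (Subtype.ext hbb'))

theorem exists_isExceptional_of_injOn (hS : S.encard = 3) (hfst : S.InjOn Prod.fst)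
    (hsnd : S.InjOn Prod.snd) :
    ∃ D E, IsExceptional S D E ∧ D.encard + E.encard ≤ 4 := by
  obtain ⟨x, y, z, hxy, hxz, hyz, rfl⟩ := Set.encard_eq_three.1 hS
  -- The row and the column through `x` both stay: their connectors avoid the cell `x` itself.
  refine ⟨{y.1, z.1}, {y.2, z.2}, ?_, ?_⟩
  · simp only [Set.InjOn, Set.mem_insert_iff, Set.mem_singleton_iff] at hfst hsnd
    constructor <;> grind
  · exact (add_le_add (encard_pair_le _ _) (encard_pair_le _ _)).trans (by norm_num)

theorem exists_eq_insert_pair {V : Type*} {S : Set V} (hS : S.encard = 3) {x y : V} (hx : x ∈ S)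
    (hy : y ∈ S) (hne : x ≠ y) : ∃ z, S = {x, y, z} := by
  have hxyS : {x, y} ⊆ S := Set.pair_subset hx hy
  have hcard : (S \ {x, y}).encard + 2 = 1 + 2 := by
    rw [← Set.encard_pair hne, Set.encard_sdiff_add_encard_of_subset hxyS, hS, Set.encard_pair hne]
    norm_num
  obtain ⟨z, hz⟩ := Set.encard_eq_one.1 <|
    ENat.add_left_injective_of_ne_top (ENat.natCast_ne_top 2) hcard
  refine ⟨z, ?_⟩
  rw [← Set.sdiff_union_of_subset hxyS, hz, Set.union_comm, Set.insert_union, Set.singleton_union]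

theorem exists_isExceptional_of_not_injOn_snd (hS : S.encard = 3) (hsnd : ¬S.InjOn Prod.snd) :
    ∃ D E, IsExceptional S D E ∧ D.encard + E.encard ≤ 4 := by
  obtain ⟨x, y, z, hxy, rfl⟩ : ∃ x y z : α × β, x.2 = y.2 ∧ S = {x, y, z} := by
    simp only [Set.InjOn, not_forall] at hsnd
    obtain ⟨x, hx, y, hy, hxy, hne⟩ := hsnd
    exact ⟨x, y, (exists_eq_insert_pair hS hx hy hne).imp fun _ => .intro hxy⟩
  by_cases hz : z.2 = x.2
  · refine ⟨{x.1, y.1, z.1}, {x.2}, ?_, ?_⟩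
    · constructor <;> grind
    · grw [Set.encard_insert_le, encard_pair_le, Set.encard_singleton]
      norm_num
  · refine ⟨{x.1, y.1}, {x.2, z.2}, ?_, ?_⟩
    · constructor <;> grind
    · exact (add_le_add (encard_pair_le _ _) (encard_pair_le _ _)).trans (by norm_num)

theorem exists_isExceptional (hS : S.encard = 3) :
    ∃ D E, IsExceptional S D E ∧ D.encard + E.encard ≤ 4 := by
  by_cases hsnd : S.InjOn Prod.snd
  · by_cases hfst : S.InjOn Prod.fst
    · exact exists_isExceptional_of_injOn hS hfst hsnd
    · obtain ⟨E, D, hED, hcard⟩ := exists_isExceptional_of_not_injOn_snd (S := Prod.swap '' S)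
        (by rwa [Prod.swap_injective.encard_image]) fun h =>
        hfst fun s hs t ht hst => Prod.swap_injective (h ⟨s, hs, rfl⟩ ⟨t, ht, rfl⟩ hst)
      refine ⟨D, E, ?_, add_comm D.encard _ ▸ hcard⟩
      simpa [Set.image_image] using hED.swap
  · exact exists_isExceptional_of_not_injOn_snd hS hsnd

theorem encard_compl_add_encard_compl_add (D : Set α) (E : Set β) :
    (Dᶜ.encard + Eᶜ.encard) + (D.encard + E.encard) = ENat.card α + ENat.card β := by
  rw [add_add_add_comm, add_comm Dᶜ.encard, add_comm Eᶜ.encard, Set.encard_add_encard_compl,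
    Set.encard_add_encard_compl, Set.encard_univ, Set.encard_univ]

theorem connectivity_rookGraph_le [Nontrivial α] [Nontrivial β] :
    connectivity 3 (rookGraph α β) ≤ ENat.card α + ENat.card β - 4 := by
  obtain ⟨a, a', ha⟩ := exists_pair_ne α
  obtain ⟨b, b', hb⟩ := exists_pair_ne β
  set S : Set (α × β) := {(a, b), (a', b), (a, b')} with hS
  have encard_S : S.encard = 3 :=
    Set.encard_eq_three.2 ⟨_, _, _, by simp [ha], by simp [hb], by simp [ha.symm], hS⟩
  have neighborSet_diff : (rookGraph α β).neighborSet (a, b) \ S ⊆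
      (·, b) '' {a, a'}ᶜ ∪ (a, ·) '' {b, b'}ᶜ := by
    rintro ⟨c, d⟩
    simp only [hS, rookGraph, Set.mem_sdiff, mem_neighborSet, boxProd_adj, top_adj]
    grind
  calc connectivity 3 (rookGraph α β)
      ≤ localConnectivity _ S := connectivity_le_localConnectivity encard_S
    _ ≤ ((rookGraph α β).neighborSet (a, b) \ S).encard :=
        localConnectivity_le_encard_neighborSet_diff (encard_S ▸ by norm_num) (Set.mem_insert _ _)
    _ ≤ ({a, a'} : Set α)ᶜ.encard + ({b, b'} : Set β)ᶜ.encard := by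
        grw [neighborSet_diff, Set.encard_union_le, Set.encard_image_le, Set.encard_image_le]
    _ ≤ ENat.card α + ENat.card β - 4 := by
        refine ENat.le_sub_of_add_le_right (ENat.natCast_ne_top 4) ?_
        rw [← encard_compl_add_encard_compl_add {a, a'} {b, b'}, Set.encard_pair ha,
          Set.encard_pair hb]
        norm_num

theorem connectivity_rookGraph [Nontrivial α] [Nontrivial β] :
    connectivity 3 (rookGraph α β) = ENat.card α + ENat.card β - 4 := by
  refine connectivity_rookGraph_le.antisymm (le_connectivity fun S hS => ?_)
  obtain ⟨D, E, hDE, hcard⟩ := exists_isExceptional hS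
  refine (tsub_le_iff_right.2 ?_).trans hDE.encard_compl_add_encard_compl_le
  rw [← encard_compl_add_encard_compl_add D E]
  gcongr

end Rook

section LineGraph

theorem nonempty_iso_lineGraph_completeBipartiteGraph (α β : Type*) :
    Nonempty ((completeBipartiteGraph α β).lineGraph ≃g rookGraph α β) := by
  let edge : α × β → (completeBipartiteGraph α β).edgeSet := fun v =>
    ⟨s(.inl v.1, .inr v.2), by simp⟩
  have injective_edge : edge.Injective := fun v w h => by
    simpa [edge, Prod.ext_iff] using h
  have bijective_edge : edge.Bijective := by
    refine ⟨injective_edge, ?_⟩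
    rintro ⟨e, he⟩
    rw [edgeSet_completeBipartiteGraph] at he
    obtain ⟨v, rfl⟩ := he
    exact ⟨v, rfl⟩
  have inter_nonempty : ∀ v w, (∃ u, u ∈ (edge v).1 ∧ u ∈ (edge w).1) ↔ v.1 = w.1 ∨ v.2 = w.2 := by
    intro v w
    simp [edge, Sym2.mem_iff]
  refine ⟨.symm ⟨Equiv.ofBijective edge bijective_edge, fun {v w} => ?_⟩⟩
  rw [Equiv.ofBijective_apply, Equiv.ofBijective_apply, lineGraph_adj_iff_exists,
    injective_edge.ne_iff, inter_nonempty, boxProd_adj, top_adj, top_adj, Ne, Prod.ext_iff]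
  tauto

end LineGraph

end PendantTree

theorem mainTheorem2 (p q : ℕ) (hpq : 2 * p ≤ q) :
    ∃ (V : Type) (_ : Finite V) (G : SimpleGraph V),
      Nonempty (G ≃g completeBipartiteGraph (Fin (p + 2)) (Fin (q - p + 2))) ∧
      Nonempty (G.lineGraph ≃g
        (⊤ : SimpleGraph (Fin (p + 2))).boxProd (⊤ : SimpleGraph (Fin (q - p + 2)))) ∧
      PendantTree.connectivity 3 G = (p : ℕ∞) ∧
      PendantTree.connectivity 3 G.lineGraph = (q : ℕ∞) := by
  obtain ⟨e⟩ := PendantTree.nonempty_iso_lineGraph_completeBipartiteGraph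
    (Fin (p + 2)) (Fin (q - p + 2))
  refine ⟨_, inferInstance, completeBipartiteGraph (Fin (p + 2)) (Fin (q - p + 2)),
    ⟨.refl⟩, ⟨e⟩, ?_, ?_⟩
  · rw [PendantTree.connectivity_completeBipartiteGraph (k := 2) le_rfl (by simp) (by simp)]
    simp only [ENat.card_eq_coe_fintype_card, Fintype.card_fin]
    rw [min_eq_left (Nat.cast_le.2 (by omega))]
    norm_cast
  · rw [PendantTree.connectivity_congr e, PendantTree.connectivity_rookGraph]
    simp only [ENat.card_eq_coe_fintype_card, Fintype.card_fin]
    norm_cast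
    omega
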